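/- **Conventions.** Let $\mathbb N=\{0,1,2,\dots\}$, let $(\Lambda,\le)$ be a non-empty partially ordered set that is both upward and downward directed, and let $\mathcal M=\{M^x\in\mathbb R_{>0}^{\mathbb N}:x\in\Lambda\}$ be a *standard log-convex* weight matrix, that is: each $M^x$ is increasing; $M^x_p\le M^y_p$ for all $p$ whenever $x\le y$; and each $M=M^x$ satisfies $1=M_0\le M_1$, $M_j^2\le M_{j-1}M_{j+1}$ for all $j\ge 1$, and $\lim_{k\to\infty}(M_k)^{1/k}=+\infty$. For such a sequence $M$ put $\omega_M(t):=\sup_{p\in\mathbb N}\log\left(t^pM_0/M_p\right)$ for $t>0$, $\omega_M(0):=0$, and for $\omega=\omega_M$ put $\varphi_\omega(t):=\omega(e^t)$, $\varphi^*_\omega(s):=\sup\{sy-\varphi_\omega(y):y\ge 0\}$. For $x\in\Lambda$ and real $l>0$ let $$M^{x;l}_j:=\exp\left(\tfrac1l\,\varphi^*_{\omega_{M^x}}(lj)\right)\qquad(j\in\mathbb N).$$ For sequences write $M\preceq N$ if there are $C_1,C_2\ge 1$ with $M_p\le C_2C_1^pN_p$ for all $p\in\mathbb N$. For matrices $\mathcal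 M=\{M^x:x\in\Lambda\}$, $\mathcal N=\{N^y:y\in\Lambda'\}$ write $\mathcal M\{\preceq\}\mathcal N$ if for every $x\in\Lambda$ there is $y\in\Lambda'$ with $M^x\preceq N^y$, and $\mathcal M(\preceq)\mathcal N$ if for every $y\in\Lambda'$ there is $x\in\Lambda$ with $M^x\preceq N^y$; write $\mathcal M\{\approx\}\mathcal N$ if $\mathcal M\{\preceq\}\mathcal N$ and $\mathcal N\{\preceq\}\mathcal M$, and $\mathcal M(\approx)\mathcal N$ if $\mathcal M(\preceq)\mathcal N$ and $\mathcal N(\preceq)\mathcal M$. Consider the conditions * $(\mathcal M_{\{\mathrm{mg}\}})$: for all $x\in\Lambda$ there are $C>0$ and $y_1,y_2\in\Lambda$ such that $M^x_{j+k}\le C^{j+k}M^{y_1}_jM^{y_2}_k$ for all $j,k\in\mathbb N$; * $(\mathcal M_{(\mathrm{mg})})$: for all $x_1,x_2\in\Lambda$ there are $C>0$ and $y\in\Lambda$ such that $M^y_{j+k}\le C^{j+k}M^{x_1}_jM^{x_2}_k$ for all $j,k\in\mathbb N$. **Theorem.** Let $\mathcal M=\{M^x:x\in\Lambda\}$ be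 a standard log-convex weight matrix. 1. (Roumieu case) $\mathcal M\,\{\approx\}\,\{M^{x;l}:x\in\Lambda,\ l>0\}$ if and only if $(\mathcal M_{\{\mathrm{mg}\}})$ holds. 2. (Beurling case) If $(\mathcal M_{(\mathrm{mg})})$ holds, then $\mathcal M\,(\approx)\,\{M^{x;l}:x\in\Lambda,\ l>0\}$. If $\Lambda=\mathbb R_{>0}$ with its natural order, then $\mathcal M\,(\approx)\,\{M^{x;l}:x\in\Lambda,\ l>0\}$ if and only if $(\mathcal M_{(\mathrm{mg})})$ holds. -/

import Mathlib

open Filter Topology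

noncomputable section

namespace WeightMatrix

/-- `M ∈ 𝓛𝓒`: a positive sequence that is normalized (`1 = M 0 ≤ M 1`), log-convex,
and satisfies `(M k)^(1/k) → ∞`. -/
structure IsLC (M : ℕ → ℝ) : Prop where
  pos : ∀ k, 0 < M k
  zero_eq : M 0 = 1
  one_le : 1 ≤ M 1
  logConvex : ∀ j, M (j + 1) ^ 2 ≤ M j * M (j + 2)
  tendsto_root : Tendsto (fun k : ℕ => M k ^ (1 / (k : ℝ))) atTop atTop

/-- `{M x : x ∈ Λ}` is a standard log-convex weight matrix. -/
structure IsStandardLogConvex {Λ : Type*} [PartialOrder Λ] (M : Λ → ℕ → ℝ) : Prop where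
  increasing : ∀ x, Monotone (M x)
  mono : ∀ x y, x ≤ y → ∀ p, M x p ≤ M y p
  lc : ∀ x, IsLC (M x)

/-- The relation `M ⪯ N` between sequences. -/
def SeqLE (M N : ℕ → ℝ) : Prop :=
  ∃ C₁ C₂ : ℝ, 1 ≤ C₁ ∧ 1 ≤ C₂ ∧ ∀ p : ℕ, M p ≤ C₂ * C₁ ^ p * N p

/-- The Roumieu relation `M {⪯} N` between matrices. -/
def RoumieuLE {Λ Λ' : Type*} (M : Λ → ℕ → ℝ) (N : Λ' → ℕ → ℝ) : Prop :=
  ∀ x : Λ, ∃ y : Λ', SeqLE (M x) (N y)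

/-- The Beurling relation `M (⪯) N` between matrices. -/
def BeurlingLE {Λ Λ' : Type*} (M : Λ → ℕ → ℝ) (N : Λ' → ℕ → ℝ) : Prop :=
  ∀ y : Λ', ∃ x : Λ, SeqLE (M x) (N y)

/-- The Roumieu equivalence `M {≈} N`. -/
def RoumieuEquiv {Λ Λ' : Type*} (M : Λ → ℕ → ℝ) (N : Λ' → ℕ → ℝ) : Prop :=
  RoumieuLE M N ∧ RoumieuLE N M

/-- The Beurling equivalence `M (≈) N`. -/
def BeurlingEquiv {Λ Λ' : Type*} (M : Λ → ℕ → ℝ) (N : Λ' → ℕ → ℝ) : Prop :=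
  BeurlingLE M N ∧ BeurlingLE N M

/-- Moderate growth of Roumieu type. -/
def RoumieuMG {Λ : Type*} (M : Λ → ℕ → ℝ) : Prop :=
  ∀ x : Λ, ∃ C : ℝ, 0 < C ∧ ∃ y₁ y₂ : Λ, ∀ j k : ℕ,
    M x (j + k) ≤ C ^ (j + k) * M y₁ j * M y₂ k

/-- Moderate growth of Beurling type. -/
def BeurlingMG {Λ : Type*} (M : Λ → ℕ → ℝ) : Prop :=
  ∀ x₁ x₂ : Λ, ∃ C : ℝ, 0 < C ∧ ∃ y : Λ, ∀ j k : ℕ,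
    M y (j + k) ≤ C ^ (j + k) * M x₁ j * M x₂ k

/-- The associated function `ω_M` of a sequence: `ω_M(t) = sup_p log (t^p M_0 / M_p)` for `t > 0`
and `ω_M(0) = 0`. The supremum is finite for `M ∈ 𝓛𝓒`, see `bddAbove_assoc`. -/
def assoc (M : ℕ → ℝ) (t : ℝ) : ℝ :=
  if 0 < t then ⨆ p : ℕ, Real.log (t ^ p * M 0 / M p) else 0

/-- `φ_ω(t) = ω(e^t)`. -/
def phi (ω : ℝ → ℝ) (t : ℝ) : ℝ := ω (Real.exp t)

/-- The conjugate `φ*_ω(x) = sup {x y - φ_ω(y) : y ≥ 0}`. The supremum is finite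
for `ω = ω_M` with `M ∈ 𝓛𝓒`, see `bddAbove_phiStar`. -/
def phiStar (ω : ℝ → ℝ) (x : ℝ) : ℝ :=
  sSup ((fun y : ℝ => x * y - phi ω y) '' Set.Ici 0)

/-- The doubled-index matrix `{M^{x;l} : x ∈ Λ, l > 0}`,
`M^{x;l}_j = exp ((1/l) φ*_{ω_{M^x}} (l j))`. -/
def doubled {Λ : Type*} (M : Λ → ℕ → ℝ) : Λ × Set.Ioi (0 : ℝ) → ℕ → ℝ :=
  fun xl j => Real.exp (1 / (xl.2 : ℝ) * phiStar (assoc (M xl.1)) ((xl.2 : ℝ) * j))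

/-- For `M ∈ 𝓛𝓒` the supremum defining `ω_M(t)` is taken over a set bounded above. -/
theorem bddAbove_assoc {M : ℕ → ℝ} (hM : IsLC M) {t : ℝ} (ht : 0 < t) :
    BddAbove (Set.range fun p : ℕ => Real.log (t ^ p * M 0 / M p)) := by
  have h : ∀ᶠ p : ℕ in atTop, Real.log (t ^ p * M 0 / M p) ≤ 0 := by
    filter_upwards [hM.tendsto_root.eventually_ge_atTop t, eventually_gt_atTop 0] with p hp hp0
    have hMp := hM.pos p
    have hpow : t ^ p ≤ M p := by
      calc t ^ p ≤ (M p ^ (1 / (p : ℝ))) ^ p := pow_le_pow_left₀ ht.le hp p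
        _ = M p := by rw [one_div]; exact Real.rpow_inv_natCast_pow hMp.le hp0.ne'
    apply Real.log_nonpos
    · rw [hM.zero_eq]; positivity
    · rw [hM.zero_eq, mul_one, div_le_one hMp]; exact hpow
  obtain ⟨N, hN⟩ := eventually_atTop.1 h
  obtain ⟨B, hB⟩ := ((Set.finite_lt_nat N).image
    fun p : ℕ => Real.log (t ^ p * M 0 / M p)).bddAbove
  refine ⟨max B 0, ?_⟩
  rintro _ ⟨p, rfl⟩
  rcases lt_or_ge p N with hp | hp
  · exact (hB ⟨p, hp, rfl⟩).trans (le_max_left _ _)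
  · exact (hN p hp).trans (le_max_right _ _)

/-- For `M ∈ 𝓛𝓒` the supremum defining `φ*_{ω_M}(x)` is taken over a set bounded above. -/
theorem bddAbove_phiStar {M : ℕ → ℝ} (hM : IsLC M) (x : ℝ) :
    BddAbove ((fun y : ℝ => x * y - phi (assoc M) y) '' Set.Ici 0) := by
  obtain ⟨p, hp⟩ := exists_nat_ge x
  refine ⟨Real.log (M p), ?_⟩
  rintro _ ⟨y, hy, rfl⟩
  have hle := le_ciSup (bddAbove_assoc hM (Real.exp_pos y)) p
  have hexp : Real.log (Real.exp y ^ p * M 0 / M p) = p * y - Real.log (M p) := by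
    rw [hM.zero_eq, mul_one, Real.log_div (by positivity) (hM.pos p).ne', Real.log_pow,
      Real.log_exp]
  rw [hexp] at hle
  simp only [phi, assoc, Real.exp_pos, if_true]
  have : x * y ≤ p * y := mul_le_mul_of_nonneg_right hp hy
  linarith

end WeightMatrix

end

open Filter Topology

namespace WeightMatrix

/-! ### A single weight sequence and the convex conjugate `phiStar`. -/

section Sequence

variable {M N : ℕ → ℝ}

/-! Write φ*_x for the conjugate attached to M^x. It is convex and, since M^x is log-convex and
increasing, equals log M^x_p at each integer p (`phiStar_natCast`). Hence l = 1 returns M^x, which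
settles one half of each equivalence.

Moderate growth with j = k compares φ* at 2s and s for integer s. Convexity carries this to real s
(`phiStar_two_mul_le`), and n iterations give a factor 2^n. As (1/l) φ*(ls) increases with l, powers
of two handle every l. Conversely, midpoint convexity (`phiStar_add_le`) with l = 2 (Roumieu) or l =
1/2 (Beurling) recovers moderate growth. -/

theorem mul_sub_log_le_phi (hM : IsLC M) (p : ℕ) (y : ℝ) :
    p * y - Real.log (M p) ≤ phi (assoc M) y := by
  have hle := le_ciSup (bddAbove_assoc hM (Real.exp_pos y)) p
  have hexp : Real.log (Real.exp y ^ p * M 0 / M p) = p * y - Real.log (M p) := by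
    rw [hM.zero_eq, mul_one, Real.log_div (by positivity) (hM.pos p).ne', Real.log_pow,
      Real.log_exp]
  rw [hexp] at hle
  simpa only [phi, assoc, Real.exp_pos, if_true] using hle

theorem phi_le (hM : IsLC M) {y B : ℝ} (h : ∀ p : ℕ, p * y - Real.log (M p) ≤ B) :
    phi (assoc M) y ≤ B := by
  simp only [phi, assoc, Real.exp_pos, if_true]
  refine ciSup_le fun p => ?_
  rw [hM.zero_eq, mul_one, Real.log_div (by positivity) (hM.pos p).ne', Real.log_pow,
    Real.log_exp]
  exact h p

theorem le_phiStar (hM : IsLC M) (s : ℝ) {y : ℝ} (hy : 0 ≤ y) :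
    s * y - phi (assoc M) y ≤ phiStar (assoc M) s :=
  le_csSup (bddAbove_phiStar hM s) ⟨y, hy, rfl⟩

theorem phiStar_le {ω : ℝ → ℝ} {s B : ℝ} (h : ∀ y, 0 ≤ y → s * y - phi ω y ≤ B) :
    phiStar ω s ≤ B := by
  refine csSup_le (Set.Nonempty.image _ ⟨0, Set.self_mem_Ici⟩) ?_
  rintro _ ⟨y, hy, rfl⟩
  exact h y hy

theorem phiStar_convex (hM : IsLC M) (s t : ℝ) {a b : ℝ} (ha : 0 ≤ a) (hb : 0 ≤ b)
    (hab : a + b = 1) :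
    phiStar (assoc M) (a * s + b * t) ≤
      a * phiStar (assoc M) s + b * phiStar (assoc M) t := by
  refine phiStar_le fun y hy => ?_
  have h1 := mul_le_mul_of_nonneg_left (le_phiStar hM s hy) ha
  have h2 := mul_le_mul_of_nonneg_left (le_phiStar hM t hy) hb
  have h3 : phi (assoc M) y = a * phi (assoc M) y + b * phi (assoc M) y := by
    rw [← add_mul, hab, one_mul]
  linarith

/-- The increments of the logarithm of a log-convex sequence increase. -/
theorem monotone_log_increment (hM : IsLC M) :
    Monotone fun j => Real.log (M (j + 1)) - Real.log (M j) := by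
  refine monotone_nat_of_le_succ fun j => ?_
  have h := Real.log_le_log (pow_pos (hM.pos _) 2) (hM.logConvex j)
  rw [Real.log_pow, Real.log_mul (hM.pos _).ne' (hM.pos _).ne'] at h
  push_cast at h
  have h' : j + 1 + 1 = j + 2 := rfl
  rw [h']
  linarith

/-- As the increments increase, the slope on [i, i + 1] is a subgradient at i; sum the increments to
the right or left of i. -/
theorem log_supporting_line (hM : IsLC M) (i p : ℕ) :
    Real.log (M i) + ((p : ℝ) - i) * (Real.log (M (i + 1)) - Real.log (M i)) ≤
      Real.log (M p) := by
  have hd := monotone_log_increment hM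
  rcases le_total i p with h | h
  · induction p, h using Nat.le_induction with
    | base => simp
    | succ p hp ih =>
      have := hd hp
      simp only at this
      push_cast
      linarith
  · obtain ⟨n, rfl⟩ := Nat.exists_eq_add_of_le h
    clear h
    have key : ∀ m ≤ n, Real.log (M (p + m)) - Real.log (M p) ≤
        m * (Real.log (M (p + n + 1)) - Real.log (M (p + n))) := by
      intro m
      induction m with
      | zero => simp
      | succ m ih =>
        intro hm
        have h1 := ih (by omega)
        have h2 := hd (show p + m ≤ p + n by omega)
        simp only at h2
        push_cast
        rw [← add_assoc]
        linarith
    have := key n le_rfl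
    push_cast
    linarith

/-- `φ*` dominates the affine interpolation of `log M`. -/
theorem interpolation_le_phiStar (hM : IsLC M) (hmono : Monotone M) (i : ℕ) (θ : ℝ) :
    (1 - θ) * Real.log (M i) + θ * Real.log (M (i + 1)) ≤ phiStar (assoc M) (i + θ) := by
  -- The slope on [i, i + 1] is the test point in the supremum; it must be nonnegative, hence the
  -- use of monotonicity.
  have hy : 0 ≤ Real.log (M (i + 1)) - Real.log (M i) :=
    sub_nonneg.2 (Real.log_le_log (hM.pos i) (hmono i.le_succ))
  have h1 := le_phiStar hM (i + θ) hy
  have h2 := phi_le hM (y := Real.log (M (i + 1)) - Real.log (M i))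
    (B := i * (Real.log (M (i + 1)) - Real.log (M i)) - Real.log (M i)) fun p => by
      linarith [log_supporting_line hM i p]
  linarith

theorem phiStar_natCast (hM : IsLC M) (hmono : Monotone M) (p : ℕ) :
    phiStar (assoc M) p = Real.log (M p) := by
  refine le_antisymm (phiStar_le fun y _ => ?_) ?_
  · linarith [mul_sub_log_le_phi hM p y]
  · simpa using interpolation_le_phiStar hM hmono p 0

theorem phiStar_zero (hM : IsLC M) (hmono : Monotone M) : phiStar (assoc M) 0 = 0 := by
  simpa [hM.zero_eq] using phiStar_natCast hM hmono 0

/-- Difference quotients at 0 of a convex function vanishing at 0 increase. -/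
theorem inv_mul_phiStar_mono (hM : IsLC M) (hmono : Monotone M) {l l' : ℝ} (hl : 0 < l)
    (hll' : l ≤ l') (s : ℝ) :
    1 / l * phiStar (assoc M) (l * s) ≤ 1 / l' * phiStar (assoc M) (l' * s) := by
  have hl' : 0 < l' := hl.trans_le hll'
  have h := phiStar_convex hM (l' * s) 0
    (a := l / l') (b := 1 - l / l') (by positivity)
    (sub_nonneg.2 ((div_le_one hl').2 hll')) (by ring)
  simp only [mul_zero, add_zero, phiStar_zero hM hmono] at h
  rw [show l / l' * (l' * s) = l * s by field_simp] at h
  calc 1 / l * phiStar (assoc M) (l * s)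
      ≤ 1 / l * (l / l' * phiStar (assoc M) (l' * s)) := by gcongr
    _ = 1 / l' * phiStar (assoc M) (l' * s) := by field_simp

theorem phiStar_add_le (hM : IsLC M) (s t : ℝ) :
    2 * phiStar (assoc M) (s + t) ≤
      phiStar (assoc M) (2 * s) + phiStar (assoc M) (2 * t) := by
  have h := phiStar_convex hM (2 * s) (2 * t)
    (a := 1 / 2) (b := 1 / 2) (by norm_num) (by norm_num) (by norm_num)
  rw [show 1 / 2 * (2 * s) + 1 / 2 * (2 * t) = s + t by ring] at h
  linarith

/-- A doubling estimate for `log M` at the integers extends to the conjugates. -/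
theorem phiStar_two_mul_le (hM : IsLC M) (hMm : Monotone M) (hN : IsLC N) (hNm : Monotone N)
    {c : ℝ} (h : ∀ j : ℕ, Real.log (M (j + j)) ≤ c * (j + j) + Real.log (N j) + Real.log (N j))
    {s : ℝ} (hs : 0 ≤ s) :
    phiStar (assoc M) (2 * s) ≤ 2 * c * s + 2 * phiStar (assoc N) s := by
  set i := ⌊s⌋₊ with hi
  obtain ⟨θ, hθ⟩ : ∃ θ, θ = s - i := ⟨_, rfl⟩
  have hθ0 : 0 ≤ θ := by rw [hθ]; exact sub_nonneg.2 (Nat.floor_le hs)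
  have hθ1 : 0 ≤ 1 - θ := by rw [hθ]; linarith [Nat.lt_floor_add_one s]
  -- With s = i + θ, 2s lies between the even integers 2i and 2i + 2, where `h` applies; the
  -- resulting interpolation of log N lies below φ* of N.
  have hconv := phiStar_convex hM ((i + i : ℕ) : ℝ)
    ((i + 1 + (i + 1) : ℕ) : ℝ) hθ1 hθ0 (by ring)
  rw [phiStar_natCast hM hMm, phiStar_natCast hM hMm] at hconv
  rw [show (1 - θ) * ((i + i : ℕ) : ℝ) + θ * ((i + 1 + (i + 1) : ℕ) : ℝ) = 2 * s by
    push_cast; rw [hθ]; ring] at hconv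
  have hint := interpolation_le_phiStar hN hNm i θ
  rw [show (i : ℝ) + θ = s by rw [hθ]; ring] at hint
  have h1 := mul_le_mul_of_nonneg_left (h i) hθ1
  have h2 := mul_le_mul_of_nonneg_left (h (i + 1)) hθ0
  have h3 : s = i + θ := by rw [hθ]; ring
  push_cast at h2
  have h4 : 2 * c * s = (1 - θ) * (c * (i + i)) + θ * (c * ((i + 1) + (i + 1))) := by
    rw [h3]; ring
  linarith

theorem seqLE_of_log_le (hM : ∀ p, 0 < M p) (hN : ∀ p, 0 < N p) {b : ℝ}
    (h : ∀ p : ℕ, Real.log (M p) ≤ b * p + Real.log (N p)) : SeqLE M N := by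
  -- `SeqLE` demands C₁ ≥ 1, so a negative b is replaced by 0.
  refine ⟨Real.exp (max b 0), 1, Real.one_le_exp (le_max_right _ _), le_rfl, fun p => ?_⟩
  rw [one_mul, ← Real.exp_nat_mul, ← Real.exp_log (hN p), ← Real.exp_add,
    ← Real.log_le_iff_le_exp (hM p)]
  refine (h p).trans ?_
  have := mul_le_mul_of_nonneg_right (le_max_left b 0) (Nat.cast_nonneg (α := ℝ) p)
  linarith

theorem SeqLE.exists_log_le (hM : ∀ p, 0 < M p) (hN : ∀ p, 0 < N p) (h : SeqLE M N) :
    ∃ a b : ℝ, 0 ≤ a ∧ 0 ≤ b ∧ ∀ p : ℕ, Real.log (M p) ≤ a + b * p + Real.log (N p) := by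
  obtain ⟨C₁, C₂, h1, h2, h⟩ := h
  refine ⟨Real.log C₂, Real.log C₁, Real.log_nonneg h2, Real.log_nonneg h1, fun p => ?_⟩
  have h1' : C₁ ^ p ≠ 0 := by positivity
  have h2' : C₂ ≠ 0 := by positivity
  have := Real.log_le_log (hM p) (h p)
  rw [Real.log_mul (mul_ne_zero h2' h1') (hN p).ne', Real.log_mul h2' h1', Real.log_pow] at this
  linarith

theorem log_add_le_of_le {N' : ℕ → ℝ} (hM : ∀ p, 0 < M p) (hN : ∀ p, 0 < N p)
    (hN' : ∀ p, 0 < N' p) {C : ℝ} (hC : 0 < C) {j k : ℕ}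
    (h : M (j + k) ≤ C ^ (j + k) * N j * N' k) :
    Real.log (M (j + k)) ≤ Real.log C * (j + k) + Real.log (N j) + Real.log (N' k) := by
  have hC' : C ^ (j + k) ≠ 0 := by positivity
  have := Real.log_le_log (hM _) h
  rw [Real.log_mul (mul_ne_zero hC' (hN j).ne') (hN' k).ne', Real.log_mul hC' (hN j).ne',
    Real.log_pow] at this
  push_cast at this
  linarith

theorem le_of_log_add_le {N' : ℕ → ℝ} (hM : ∀ p, 0 < M p) (hN : ∀ p, 0 < N p)
    (hN' : ∀ p, 0 < N' p) {c : ℝ} {j k : ℕ}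
    (h : Real.log (M (j + k)) ≤ c * (j + k) + Real.log (N j) + Real.log (N' k)) :
    M (j + k) ≤ Real.exp c ^ (j + k) * N j * N' k := by
  rw [← Real.exp_nat_mul, ← Real.exp_log (hN j), ← Real.exp_log (hN' k), ← Real.exp_add,
    ← Real.exp_add, ← Real.log_le_iff_le_exp (hM _)]
  push_cast
  linarith

/-- For normalized sequences the additive constant in a moderate growth estimate can be absorbed
into the linear term. -/
theorem log_add_le_absorb {N' : ℕ → ℝ} (hM : IsLC M) (hN : IsLC N) (hN' : IsLC N') {a b : ℝ}
    (ha : 0 ≤ a) {j k : ℕ}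
    (h : Real.log (M (j + k)) ≤ a + b * (j + k) + Real.log (N j) + Real.log (N' k)) :
    Real.log (M (j + k)) ≤ (a + b) * (j + k) + Real.log (N j) + Real.log (N' k) := by
  rcases Nat.eq_zero_or_pos (j + k) with h0 | h0
  · obtain ⟨rfl, rfl⟩ : j = 0 ∧ k = 0 := by omega
    simp [hM.zero_eq, hN.zero_eq, hN'.zero_eq]
  · have h1 : (1 : ℝ) ≤ j + k := by exact_mod_cast h0
    have := mul_le_mul_of_nonneg_left h1 ha
    linarith

end Sequence

/-! ### Weight matrices: moderate growth against change of l. -/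

section Matrix

variable {Λ : Type*} {M : Λ → ℕ → ℝ}

theorem doubled_pos (xl : Λ × Set.Ioi (0 : ℝ)) (j : ℕ) : 0 < doubled M xl j :=
  Real.exp_pos _

theorem log_doubled (xl : Λ × Set.Ioi (0 : ℝ)) (j : ℕ) :
    Real.log (doubled M xl j) =
      1 / (xl.2 : ℝ) * phiStar (assoc (M xl.1)) ((xl.2 : ℝ) * j) :=
  Real.log_exp _

variable [PartialOrder Λ]

theorem doubled_one (hM : IsStandardLogConvex M) (x : Λ) :
    doubled M (x, ⟨1, Set.mem_Ioi.2 one_pos⟩) = M x := by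
  funext j
  simp [doubled, phiStar_natCast (hM.lc x) (hM.increasing x), Real.exp_log ((hM.lc x).pos j)]

theorem SeqLE.rfl {N : ℕ → ℝ} : SeqLE N N :=
  ⟨1, 1, le_rfl, le_rfl, fun p => by simp⟩

theorem roumieuLE_doubled (hM : IsStandardLogConvex M) : RoumieuLE M (doubled M) := fun x =>
  ⟨(x, ⟨1, Set.mem_Ioi.2 one_pos⟩), by rw [doubled_one hM]; exact SeqLE.rfl⟩

theorem beurlingLE_doubled (hM : IsStandardLogConvex M) : BeurlingLE (doubled M) M := fun x =>
  ⟨(x, ⟨1, Set.mem_Ioi.2 one_pos⟩), by rw [doubled_one hM]; exact SeqLE.rfl⟩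

theorem log_mono (hM : IsStandardLogConvex M) {x y : Λ} (h : x ≤ y) (p : ℕ) :
    Real.log (M x p) ≤ Real.log (M y p) :=
  Real.log_le_log ((hM.lc x).pos p) (hM.mono x y h p)

theorem exists_two_pow_le_of_roumieuMG [IsDirectedOrder Λ] (hM : IsStandardLogConvex M)
    (h : RoumieuMG M) (x : Λ) (n : ℕ) :
    ∃ (y : Λ) (c : ℝ), ∀ s : ℝ, 0 ≤ s →
      phiStar (assoc (M x)) (2 ^ n * s) ≤ c * s + 2 ^ n * phiStar (assoc (M y)) s := by
  induction n with
  | zero => exact ⟨x, 0, fun s _ => by simp⟩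
  | succ n ih =>
    obtain ⟨z, c, hz⟩ := ih
    obtain ⟨C, hC, y₁, y₂, hy⟩ := h z
    obtain ⟨y, h1, h2⟩ := exists_ge_ge y₁ y₂
    refine ⟨y, 2 * c + 2 ^ n * (2 * Real.log C), fun s hs => ?_⟩
    have hd := phiStar_two_mul_le (hM.lc z) (hM.increasing z) (hM.lc y) (hM.increasing y)
      (c := Real.log C) (fun j => by
        have := log_add_le_of_le (hM.lc z).pos (hM.lc y₁).pos (hM.lc y₂).pos hC (hy j j)
        linarith [log_mono hM h1 j, log_mono hM h2 j]) hs
    -- The new doubling is innermost, at s, so the index moves on from z to y.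
    have h3 := hz (2 * s) (by positivity)
    have h4 := mul_le_mul_of_nonneg_left hd (show (0 : ℝ) ≤ 2 ^ n by positivity)
    rw [pow_succ, mul_assoc]
    linarith

theorem exists_two_pow_le_of_beurlingMG (hM : IsStandardLogConvex M) (h : BeurlingMG M) (x : Λ)
    (n : ℕ) :
    ∃ (y : Λ) (c : ℝ), ∀ s : ℝ, 0 ≤ s →
      phiStar (assoc (M y)) (2 ^ n * s) ≤ c * s + 2 ^ n * phiStar (assoc (M x)) s := by
  induction n with
  | zero => exact ⟨x, 0, fun s _ => by simp⟩
  | succ n ih =>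
    obtain ⟨z, c, hz⟩ := ih
    obtain ⟨C, hC, y, hy⟩ := h z z
    refine ⟨y, 2 ^ n * (2 * Real.log C) + 2 * c, fun s hs => ?_⟩
    -- Here the index on the left is the one sought, so the new doubling is outermost, at 2^n s.
    have hd := phiStar_two_mul_le (hM.lc y) (hM.increasing y) (hM.lc z) (hM.increasing z)
      (fun j => log_add_le_of_le (hM.lc y).pos (hM.lc z).pos (hM.lc z).pos hC (hy j j))
      (mul_nonneg (show (0 : ℝ) ≤ 2 ^ n by positivity) hs)
    have h3 := hz s hs
    rw [pow_succ, mul_comm (2 ^ n : ℝ) 2, mul_assoc]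
    linarith

theorem roumieuLE_of_roumieuMG [IsDirectedOrder Λ] (hM : IsStandardLogConvex M)
    (h : RoumieuMG M) : RoumieuLE (doubled M) M := by
  rintro ⟨x, l, hl⟩
  obtain ⟨n, hn⟩ := pow_unbounded_of_one_lt l (one_lt_two (α := ℝ))
  obtain ⟨y, c, hy⟩ := exists_two_pow_le_of_roumieuMG hM h x n
  refine ⟨y, seqLE_of_log_le (doubled_pos _) (hM.lc y).pos (b := c / 2 ^ n) fun p => ?_⟩
  rw [log_doubled]
  refine (inv_mul_phiStar_mono (hM.lc x) (hM.increasing x) hl hn.le p).trans ?_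
  have h1 := hy p p.cast_nonneg
  rw [phiStar_natCast (hM.lc y) (hM.increasing y)] at h1
  have h2 : (0 : ℝ) < 2 ^ n := by positivity
  calc 1 / 2 ^ n * phiStar (assoc (M x)) (2 ^ n * p)
      ≤ 1 / 2 ^ n * (c * p + 2 ^ n * Real.log (M y p)) := by gcongr
    _ = c / 2 ^ n * p + Real.log (M y p) := by field_simp

theorem beurlingLE_of_beurlingMG (hM : IsStandardLogConvex M) (h : BeurlingMG M) :
    BeurlingLE M (doubled M) := by
  rintro ⟨x, l, hl : 0 < l⟩
  obtain ⟨n, hn⟩ := pow_unbounded_of_one_lt l⁻¹ (one_lt_two (α := ℝ))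
  have h2 : (0 : ℝ) < 2 ^ n := by positivity
  obtain ⟨y, c, hy⟩ := exists_two_pow_le_of_beurlingMG hM h x n
  refine ⟨y, seqLE_of_log_le (hM.lc y).pos (doubled_pos _) (b := c / 2 ^ n) fun p => ?_⟩
  rw [log_doubled]
  have hmono := inv_mul_phiStar_mono (hM.lc x) (hM.increasing x) (inv_pos.2 h2)
    (inv_le_of_inv_le₀ hl hn.le) p
  have h1 := hy ((2 ^ n)⁻¹ * p) (by positivity)
  rw [mul_inv_cancel_left₀ h2.ne', phiStar_natCast (hM.lc y) (hM.increasing y)] at h1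
  rw [one_div, inv_inv] at hmono
  have h3 : c / 2 ^ n * p = c * ((2 ^ n)⁻¹ * p) := by ring
  simp only
  linarith

theorem roumieuMG_of_roumieuLE (hM : IsStandardLogConvex M) (h : RoumieuLE (doubled M) M) :
    RoumieuMG M := by
  intro x
  -- For l = 2, midpoint convexity reads M^x_{j+k} ≤ M^{x;2}_j M^{x;2}_k; both factors are then
  -- compared with M^y, so a is paid twice.
  obtain ⟨y, hy⟩ := h (x, ⟨2, Set.mem_Ioi.2 two_pos⟩)
  obtain ⟨a, b, ha, -, hab⟩ := hy.exists_log_le (doubled_pos _) (hM.lc y).pos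
  refine ⟨Real.exp (2 * a + b), Real.exp_pos _, y, y, fun j k => ?_⟩
  refine le_of_log_add_le (hM.lc x).pos (hM.lc y).pos (hM.lc y).pos ?_
  refine log_add_le_absorb (hM.lc x) (hM.lc y) (hM.lc y) (by positivity) ?_
  have hj := hab j
  have hk := hab k
  rw [log_doubled] at hj hk
  simp only at hj hk
  have h1 := phiStar_add_le (hM.lc x) j k
  rw [← Nat.cast_add, phiStar_natCast (hM.lc x) (hM.increasing x)] at h1
  linarith

theorem beurlingMG_of_beurlingLE [IsCodirectedOrder Λ] (hM : IsStandardLogConvex M)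
    (h : BeurlingLE M (doubled M)) : BeurlingMG M := by
  intro x₁ x₂
  obtain ⟨x, h1, h2⟩ := exists_le_le x₁ x₂
  -- For l = 1/2, midpoint convexity reads M^{x;1/2}_{j+k} ≤ M^x_j M^x_k.
  obtain ⟨y, hy⟩ := h (x, ⟨1 / 2, Set.mem_Ioi.2 one_half_pos⟩)
  obtain ⟨a, b, ha, -, hab⟩ := hy.exists_log_le (hM.lc y).pos (doubled_pos _)
  refine ⟨Real.exp (a + b), Real.exp_pos _, y, fun j k => ?_⟩
  refine le_of_log_add_le (hM.lc y).pos (hM.lc x₁).pos (hM.lc x₂).pos ?_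
  refine log_add_le_absorb (hM.lc y) (hM.lc x₁) (hM.lc x₂) ha ?_
  have hjk := hab (j + k)
  rw [log_doubled] at hjk
  have h3 := phiStar_add_le (hM.lc x) (1 / 2 * j) (1 / 2 * k)
  rw [show (2 : ℝ) * (1 / 2 * j) = j by ring, show (2 : ℝ) * (1 / 2 * k) = k by ring, ← mul_add,
    phiStar_natCast (hM.lc x) (hM.increasing x),
    phiStar_natCast (hM.lc x) (hM.increasing x)] at h3
  push_cast at hjk
  linarith [log_mono hM h1 j, log_mono hM h2 k]

end Matrix

end WeightMatrix

theorem mainTheorem4 :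
    (∀ (Λ : Type*) [PartialOrder Λ] [Nonempty Λ] [IsDirectedOrder Λ] [IsCodirectedOrder Λ]
        (M : Λ → ℕ → ℝ), WeightMatrix.IsStandardLogConvex M →
      (WeightMatrix.RoumieuEquiv M (WeightMatrix.doubled M) ↔ WeightMatrix.RoumieuMG M) ∧
      (WeightMatrix.BeurlingMG M → WeightMatrix.BeurlingEquiv M (WeightMatrix.doubled M))) ∧
    (∀ M : Set.Ioi (0 : ℝ) → ℕ → ℝ, WeightMatrix.IsStandardLogConvex M →
      (WeightMatrix.BeurlingEquiv M (WeightMatrix.doubled M) ↔ WeightMatrix.BeurlingMG M)) := by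
  refine ⟨fun Λ _ _ _ _ M hM => ⟨⟨fun h => ?_, fun h => ?_⟩, fun h => ?_⟩,
    fun M hM => ⟨fun h => ?_, fun h => ?_⟩⟩
  · exact WeightMatrix.roumieuMG_of_roumieuLE hM h.2
  · exact ⟨WeightMatrix.roumieuLE_doubled hM, WeightMatrix.roumieuLE_of_roumieuMG hM h⟩
  · exact ⟨WeightMatrix.beurlingLE_of_beurlingMG hM h, WeightMatrix.beurlingLE_doubled hM⟩
  · exact WeightMatrix.beurlingMG_of_beurlingLE hM h.1
  · exact ⟨WeightMatrix.beurlingLE_of_beurlingMG hM h, WeightMatrix.beurlingLE_doubled hM⟩
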